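/- **Corollary 3.8.** Let $r$ be a non-negative integer and let $f(\mathbf z)=\sum_{k} c_k\mathbf z^{k}\in\mathbb C[z_1^{\pm1},\dots,z_r^{\pm1}]$ be a Laurent polynomial. Its amoeba $\mathcal A_f\subset\mathbb R^r$ is the image of its zero set in $(\mathbb C^*)^r$ under $\mathrm{Log}(\mathbf z)=(\log|z_1|,\dots,\log|z_r|)$, and its Newton polytope $\Delta(f)$ is the convex hull in $\mathbb R^r$ of the exponents of the monomials that appear in $f$. For $\mathbf a\in\mathbb R^r$ let $f\{\mathbf a\}$ be the list of the absolute values on $\mathrm{Log}^{-1}(\mathbf a)$ of the (non-zero) terms $c_k\mathbf z^k$ of $f$. For a positive integer $n$ let $$f_n(\mathbf z)=\prod_{k_1=0}^{n-1}\cdots\prod_{k_r=0}^{n-1} f\big(e^{2\pi i k_1/n}z_1,\dots,e^{2\pi i k_r/n}z_r\big).$$ A list $\{b_1,\dots,b_s\}$ of positive numbers is called $d'$-superlopsided if $d'\ge s-1$ and there is an $i$ such that $b_i>d'b_j$ for all $j\ne i$. Let $\Delta\subset\mathbb R^r$, let $d$ be a real number with $\#(\mathbb Z^r\cap m\Delta)\le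 d\,m^r$ for all integers $m\ge1$, let $\alpha>d$ and let $\varepsilon>0$. Then there is an integer $N$ (depending only on $r,\Delta,\alpha,\varepsilon$ and $d$) such that for all $n\ge N$, all $f$ with $\Delta(f)=\Delta$, and all $\mathbf a\in\mathbb R^r$ whose Euclidean distance to every point of $\mathcal A_f$ is at least $\varepsilon$, the list $f_n\{\mathbf a\}$ is $(\alpha n^{r^2-r})$-superlopsided. Moreover, let $f$ be given and let $\mathbf a\in\mathbb R^r\setminus\mathcal A_f$. If $d$ is a real number with $\#(\mathbb Z^r\cap m\Delta(f))\le d\,m^r$ for all integers $m\ge1$, and $\alpha>d$, then $f_n\{\mathbf a\}$ is $(\alpha n^{r^2-r})$-superlopsided for all sufficiently large $n$. Also, writing $f_n\{\mathbf a\}=\{b_{n1},\dots,b_{nd_n}\}$, there are indices $k_n$ such that for all sufficiently large $n$ the entry $b_{nk_n}$ is greater than the sum of the other entries, and $$\lim_{n\to\infty}\frac{\sum_{j\ne k_n}b_{nj}}{b_{nk_n}}=0 .$$ -/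

import Mathlib

open scoped Pointwise

noncomputable section

namespace Amoeba

/-- Laurent polynomials in `r` variables over `ℂ`; `f.coeff k` is the coefficient of
`z₁ ^ k₁ ⋯ z_r ^ k_r`. -/
abbrev LaurentPoly (r : ℕ) : Type := AddMonoidAlgebra ℂ (Fin r → ℤ)

/-- The complex torus `(ℂ^*)^r`. -/
abbrev Torus (r : ℕ) : Type := Fin r → ℂˣ

variable {r : ℕ}

/-- The Laurent monomial `z₁ ^ k₁ ⋯ z_r ^ k_r`. -/
def monomial (z : Torus r) (k : Fin r → ℤ) : ℂ := ∏ i, (z i : ℂ) ^ k i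

/-- The term of `f` with exponent `k`, evaluated at `z`. -/
def term (f : LaurentPoly r) (k : Fin r → ℤ) (z : Torus r) : ℂ := f.coeff k * monomial z k

/-- The exponents of the monomials that appear in `f`. -/
def exponents (f : LaurentPoly r) : Finset (Fin r → ℤ) := f.coeff.support

/-- The value `f(z)`, the sum of the terms of `f` at `z`. -/
def eval (f : LaurentPoly r) (z : Torus r) : ℂ := ∑ k ∈ exponents f, term f k z

/-- `Log(z) = (log |z₁|, …, log |z_r|)`. -/
def logMap (z : Torus r) : EuclideanSpace ℝ (Fin r) :=
  WithLp.toLp 2 fun i => Real.log ‖(z i : ℂ)‖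

/-- The amoeba of `f`, the image under `Log` of the zero locus of `f` in the torus. -/
def amoeba (f : LaurentPoly r) : Set (EuclideanSpace ℝ (Fin r)) :=
  logMap '' {z | eval f z = 0}

/-- The point `(e ^ a₁, …, e ^ a_r)` of `Log⁻¹(a)`. -/
def expPoint (a : EuclideanSpace ℝ (Fin r)) : Torus r :=
  fun i => Units.mk0 (Complex.exp (a i)) (Complex.exp_ne_zero _)

/-- The absolute value of the term of `f` with exponent `k` on `Log⁻¹(a)`. The list `f{a}` is the
family of the numbers `termAbs f a k` with `k ∈ exponents f`. -/
def termAbs (f : LaurentPoly r) (a : EuclideanSpace ℝ (Fin r)) (k : Fin r → ℤ) : ℝ :=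
  ‖term f k (expPoint a)‖

/-- `termAbs` can be computed at any point of `Log⁻¹(a)`. -/
theorem norm_term_eq_termAbs (f : LaurentPoly r) (k : Fin r → ℤ) (z : Torus r) :
    ‖term f k z‖ = termAbs f (logMap z) k := by
  have h : ∀ i, ‖(expPoint (logMap z) i : ℂ)‖ = ‖(z i : ℂ)‖ := fun i => by
    simp only [expPoint, logMap, Units.val_mk0, Complex.norm_exp, Complex.ofReal_re]
    exact Real.exp_log (norm_pos_iff.2 (z i).ne_zero)
  simp [termAbs, term, monomial, norm_prod, norm_zpow, h]

/-- The family of positive numbers `b j`, `j ∈ S`, is `d'`-superlopsided: `d'` is at least the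
number of entries minus one, and some entry exceeds `d'` times each other entry. -/
def Superlopsided {ι : Type*} (S : Finset ι) (b : ι → ℝ) (d' : ℝ) : Prop :=
  (S.card : ℝ) - 1 ≤ d' ∧ ∃ i ∈ S, ∀ j ∈ S, j ≠ i → d' * b j < b i

/-- The Laurent polynomial `f(u₁ z₁, …, u_r z_r)`. -/
def twist (u : Torus r) (f : LaurentPoly r) : LaurentPoly r :=
  ∑ k ∈ exponents f, AddMonoidAlgebra.single k (f.coeff k * monomial u k)

/-- The point `(e ^ (2πi κ₁ / n), …, e ^ (2πi κ_r / n))`. -/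
def rootPoint (n : ℕ) (κ : Fin r → Fin n) : Torus r :=
  fun i => Units.mk0 (Complex.exp (2 * Real.pi * Complex.I * ((κ i : ℕ) : ℂ) / (n : ℂ)))
    (Complex.exp_ne_zero _)

/-- The cyclic resultant `f_n(z) = ∏_{κ₁ = 0}^{n - 1} ⋯ ∏_{κ_r = 0}^{n - 1}
f(e ^ (2πi κ₁ / n) z₁, …, e ^ (2πi κ_r / n) z_r)`. -/
def cyclicResultant (n : ℕ) (f : LaurentPoly r) : LaurentPoly r :=
  ∏ κ : Fin r → Fin n, twist (rootPoint n κ) f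

/-- The Newton polytope of `f`, the convex hull in `ℝ^r` of the exponents that appear in `f`. -/
def newtonPolytope (f : LaurentPoly r) : Set (EuclideanSpace ℝ (Fin r)) :=
  convexHull ℝ ((fun k : Fin r → ℤ => WithLp.toLp 2 fun i => (k i : ℝ)) '' (exponents f : Set _))

/-- The set of integral points `ℤ^r ∩ P`. -/
def integralPoints (P : Set (EuclideanSpace ℝ (Fin r))) : Set (Fin r → ℤ) :=
  {k | (WithLp.toLp 2 fun i => (k i : ℝ)) ∈ P}

/-- `d` is an upper bound for the numbers `#(ℤ^r ∩ mΔ) / m ^ r`, where `m = 1, 2, 3, …`. -/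
def IsLatticePointBound (Δ : Set (EuclideanSpace ℝ (Fin r))) (d : ℝ) : Prop :=
  ∀ m : ℕ, 1 ≤ m → ((integralPoints ((m : ℝ) • Δ)).ncard : ℝ) / (m : ℝ) ^ r ≤ d

end Amoeba

end

noncomputable section

namespace Amoeba

variable {r : ℕ}

/-! Let `a` have distance at least `ε` from the amoeba. Vary one coordinate `t` of a point of the
fibre over `a`: `f` becomes `C t^(-B) ∏ (ρ - t)` with at most `2B` roots. A non-zero root gives a
zero of `f` whose `Log` differs from `a` in one coordinate only, so `log |ρ|` and `log |t|` differ
by at least `ε`. Multiplying over `n`-th roots of unity turns `ρ - t` into `ρ^n - t^n`, where one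
summand is smaller than the other by the factor `e^(-εn)`. Hence rotating `t` by `u` of modulus one
multiplies this product by almost exactly a power of `u`.

The resultant `f_n` is a product of `n^(r-1)` such one-variable products
(`exists_near_eval_cyclicResultant`). The power of `u` could depend on the other arguments, but the
torus is connected and distinct powers are far apart, so it does not (`exists_near_monomial`). Thus
`f_n(uz)` is close to `u^K f_n(z)` on the whole fibre, with relative error `δ`. Fourier averaging
(`termAbs_of_near_monomial`) shows that the term at `K` is at least `(1 - δ)|f_n(z)|` and every
other term at most `δ|f_n(z)|`.

The exponents of `f_n` are divisible by `n` and lie in `n^r Δ`; dividing by `n` puts them in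
`n^(r-1) Δ`, so there are at most `d n^(r^2-r)` terms. As `δ` decays faster than any power of `n`
and is bounded in terms of `r`, `B`, `ε` and `n` alone, all claims follow, uniformly in `f`. -/

theorem monomial_mul (z w : Torus r) (k : Fin r → ℤ) :
    monomial (z * w) k = monomial z k * monomial w k := by
  simp [monomial, mul_zpow, Finset.prod_mul_distrib]

theorem monomial_add (z : Torus r) (k l : Fin r → ℤ) :
    monomial z (k + l) = monomial z k * monomial z l := by
  simp [monomial, zpow_add₀, Finset.prod_mul_distrib]

theorem monomial_zero (z : Torus r) : monomial z 0 = 1 := by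
  simp [monomial]

theorem monomial_ne_zero (z : Torus r) (k : Fin r → ℤ) : monomial z k ≠ 0 :=
  Finset.prod_ne_zero_iff.2 fun i _ => zpow_ne_zero _ (z i).ne_zero

/-- Evaluation at a point of the torus, as a homomorphism of algebras. -/
def evalHom (z : Torus r) : LaurentPoly r →ₐ[ℂ] ℂ :=
  AddMonoidAlgebra.lift ℂ ℂ (Fin r → ℤ)
    { toFun := fun k => monomial z k.toAdd
      map_one' := monomial_zero z
      map_mul' := fun k l => monomial_add z k.toAdd l.toAdd }

theorem evalHom_apply (z : Torus r) (f : LaurentPoly r) : evalHom z f = eval f z := by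
  rw [evalHom, AddMonoidAlgebra.lift_apply]
  rfl

theorem eval_single (k : Fin r → ℤ) (c : ℂ) (z : Torus r) :
    eval (AddMonoidAlgebra.single k c) z = c * monomial z k := by
  rw [← evalHom_apply, evalHom, AddMonoidAlgebra.lift_single]
  rfl

theorem eval_twist (u : Torus r) (f : LaurentPoly r) (z : Torus r) :
    eval (twist u f) z = eval f (u * z) := by
  rw [← evalHom_apply, twist, map_sum]
  simp only [evalHom_apply, eval_single]
  simp only [eval, term, monomial_mul, mul_assoc]

theorem eval_cyclicResultant (n : ℕ) (f : LaurentPoly r) (z : Torus r) :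
    eval (cyclicResultant n f) z = ∏ κ : Fin r → Fin n, eval f (rootPoint n κ * z) := by
  rw [← evalHom_apply, cyclicResultant, map_prod]
  simp only [evalHom_apply, eval_twist]

theorem coeff_twist (u : Torus r) (f : LaurentPoly r) (k : Fin r → ℤ) :
    (twist u f).coeff k = f.coeff k * monomial u k := by
  classical
  rw [twist, AddMonoidAlgebra.coeff_sum, Finset.sum_apply']
  simp only [AddMonoidAlgebra.coeff_single, Finsupp.single_apply]
  rw [Finset.sum_ite_eq']
  split_ifs with h
  · rfl
  · rw [exponents, Finsupp.notMem_support_iff] at h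
    simp [h]

theorem exponents_twist (u : Torus r) (f : LaurentPoly r) :
    exponents (twist u f) = exponents f := by
  ext k
  simp [exponents, coeff_twist, monomial_ne_zero]

theorem rootPoint_apply (n : ℕ) (κ : Fin r → Fin n) (i : Fin r) :
    (rootPoint n κ i : ℂ) = Complex.exp (2 * Real.pi * Complex.I / n) ^ (κ i : ℕ) := by
  rw [rootPoint, Units.val_mk0, ← Complex.exp_nat_mul]
  congr 1
  ring

/-! ### Fourier extraction of coefficients. -/

/-- Orthogonality of the characters of the group of `n`-th roots of unity. -/
theorem sum_pow_zpow_eq_zero {n : ℕ} {ζ : ℂ} (hζ : IsPrimitiveRoot ζ n) {k : ℤ}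
    (hk : ¬ (n : ℤ) ∣ k) : ∑ j : Fin n, (ζ ^ (j : ℕ)) ^ k = 0 := by
  have h1 : ζ ^ k ≠ 1 := fun h => hk ((hζ.zpow_eq_one_iff_dvd k).1 h)
  have h2 : (ζ ^ k) ^ n = 1 := by
    rw [← zpow_natCast, ← zpow_mul, mul_comm, zpow_mul, zpow_natCast, hζ.pow_eq_one, one_zpow]
  have h3 : ∀ j : ℕ, (ζ ^ j) ^ k = (ζ ^ k) ^ j := fun j => by
    rw [← zpow_natCast, ← zpow_natCast, ← zpow_mul, ← zpow_mul, mul_comm]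
  simp only [h3]
  rw [Fin.sum_univ_eq_sum_range (fun j => (ζ ^ k) ^ j), geom_sum_eq h1, h2]
  simp

/-- The sum factors over the coordinates, and a coordinate with `0 < |k i| < n` contributes a
vanishing character sum. -/
theorem sum_monomial_rootPoint {n : ℕ} (hn : n ≠ 0) {k : Fin r → ℤ} (hk : k ≠ 0)
    (hb : ∀ i, |k i| < n) : ∑ κ : Fin r → Fin n, monomial (rootPoint n κ) k = 0 := by
  obtain ⟨i, hi⟩ := Function.ne_iff.1 hk
  simp only [monomial, rootPoint_apply]
  rw [← Fintype.prod_sum (fun (i : Fin r) (j : Fin n) =>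
    (Complex.exp (2 * Real.pi * Complex.I / n) ^ (j : ℕ)) ^ k i)]
  refine Finset.prod_eq_zero (Finset.mem_univ i)
    (sum_pow_zpow_eq_zero (Complex.isPrimitiveRoot_exp n hn) fun hd => hi ?_)
  exact Int.eq_zero_of_abs_lt_dvd hd (hb i)

/-- The coefficients of a Laurent polynomial, as averages over roots of unity of large order. -/
theorem sum_rootPoint_mul_eval {M : ℕ} (hM : M ≠ 0) (F : LaurentPoly r) (z : Torus r)
    (k : Fin r → ℤ) (hk : ∀ l ∈ exponents F, ∀ i, |l i - k i| < M) :
    ∑ κ : Fin r → Fin M, monomial (rootPoint M κ) (-k) * eval F (rootPoint M κ * z) =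
      (M : ℂ) ^ r * term F k z := by
  classical
  have h1 : ∀ κ : Fin r → Fin M, monomial (rootPoint M κ) (-k) * eval F (rootPoint M κ * z) =
      ∑ l ∈ exponents F, term F l z * monomial (rootPoint M κ) (l - k) := fun κ => by
    rw [eval, Finset.mul_sum]
    refine Finset.sum_congr rfl fun l _ => ?_
    rw [term, term, monomial_mul, sub_eq_add_neg, monomial_add]
    ring
  simp only [h1]
  rw [Finset.sum_comm]
  simp only [← Finset.mul_sum]
  rw [Finset.sum_eq_single k]
  · simp [monomial_zero, mul_comm]
  · intro l hl hlk
    rw [sum_monomial_rootPoint hM (sub_ne_zero.2 hlk) (hk l hl), mul_zero]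
  · intro hk'
    rw [exponents, Finsupp.notMem_support_iff] at hk'
    simp [term, hk']

theorem exists_abs_sub_lt (S : Finset (Fin r → ℤ)) :
    ∃ M : ℕ, M ≠ 0 ∧ ∀ l ∈ S, ∀ k ∈ S, ∀ i, |l i - k i| < M := by
  refine ⟨∑ l ∈ S, ∑ k ∈ S, ∑ i, (l i - k i).natAbs + 1, by omega, fun l hl k hk i => ?_⟩
  have h1 := Finset.single_le_sum (f := fun i => (l i - k i).natAbs) (fun _ _ => Nat.zero_le _)
    (Finset.mem_univ i)
  have h2 := Finset.single_le_sum (f := fun k => ∑ i, (l i - k i).natAbs)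
    (fun _ _ => Nat.zero_le _) hk
  have h3 := Finset.single_le_sum (f := fun l => ∑ k ∈ S, ∑ i, (l i - k i).natAbs)
    (fun _ _ => Nat.zero_le _) hl
  rw [Int.abs_eq_natAbs]
  exact_mod_cast Nat.lt_succ_of_le (h1.trans (h2.trans h3))

/-- If `F(u z)` is close to `u ^ K F(z)` for all `u` of absolute values one, then the term with
exponent `K` dominates. -/
theorem termAbs_of_near_monomial (F : LaurentPoly r) (z : Torus r) (K : Fin r → ℤ) {δ : ℝ}
    (h : ∀ u : Torus r, (∀ i, ‖(u i : ℂ)‖ = 1) →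
      ‖eval F (u * z) - monomial u K * eval F z‖ ≤ δ * ‖eval F z‖) :
    (1 - δ) * ‖eval F z‖ ≤ ‖term F K z‖ ∧
      ∀ k ∈ exponents F, k ≠ K → ‖term F k z‖ ≤ δ * ‖eval F z‖ := by
  classical
  -- `K` is not yet known to be an exponent of `F`, so it is inserted by hand.
  obtain ⟨M, hM, hMb⟩ := exists_abs_sub_lt (insert K (exponents F))
  have hMr : (0 : ℝ) < (M : ℝ) ^ r := by positivity
  have hnorm : ∀ κ : Fin r → Fin M, ∀ i, ‖(rootPoint M κ i : ℂ)‖ = 1 := fun κ i => by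
    rw [rootPoint_apply, norm_pow,
      (Complex.isPrimitiveRoot_exp M hM).norm'_eq_one hM, one_pow]
  have hmon : ∀ (κ : Fin r → Fin M) k, ‖monomial (rootPoint M κ) k‖ = 1 := fun κ k => by
    simp [monomial, norm_prod, norm_zpow, hnorm]
  -- Average the hypothesis against the character with exponent `-k`. The remaining character sum is
  -- `M ^ r` for `k = K` and `0` otherwise.
  have key : ∀ k ∈ insert K (exponents F),
      ‖(M : ℂ) ^ r * term F k z -
        (∑ κ : Fin r → Fin M, monomial (rootPoint M κ) (K - k)) * eval F z‖ ≤
      (M : ℝ) ^ r * (δ * ‖eval F z‖) := fun k hk => by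
    rw [← sum_rootPoint_mul_eval hM F z k
      (fun l hl => hMb l (Finset.mem_insert_of_mem hl) k hk), Finset.sum_mul,
      ← Finset.sum_sub_distrib]
    refine (norm_sum_le_of_le _ (f := _) (n := fun _ => δ * ‖eval F z‖) fun κ _ => ?_).trans ?_
    · rw [sub_eq_neg_add K k, monomial_add, mul_assoc, ← mul_sub, norm_mul, hmon, one_mul]
      exact h _ (hnorm κ)
    · simp
  constructor
  · have h1 := key K (Finset.mem_insert_self _ _)
    simp only [sub_self, monomial_zero, Finset.sum_const, Finset.card_univ, Fintype.card_pi,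
      Fintype.card_fin, Finset.prod_const, nsmul_eq_mul, Nat.cast_pow, mul_one] at h1
    rw [← mul_sub, norm_mul, norm_pow, Complex.norm_natCast] at h1
    have h2 := le_of_mul_le_mul_left h1 hMr
    have h3 := norm_sub_norm_le (eval F z) (term F K z)
    rw [norm_sub_rev] at h3
    linarith
  · intro k hk hkK
    have h1 := key k (Finset.mem_insert_of_mem hk)
    rw [sum_monomial_rootPoint hM (sub_ne_zero.2 hkK.symm) (hMb K (Finset.mem_insert_self _ _) k
      (Finset.mem_insert_of_mem hk)), zero_mul, sub_zero, norm_mul, norm_pow,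
      Complex.norm_natCast] at h1
    exact le_of_mul_le_mul_left h1 hMr

/-! ### Exponents of the cyclic resultant and their number. -/

/-- The embedding of the lattice of exponents into Euclidean space. -/
abbrev latticePoint (k : Fin r → ℤ) : EuclideanSpace ℝ (Fin r) :=
  WithLp.toLp 2 fun i => (k i : ℝ)

theorem latticePoint_mem_newtonPolytope {f : LaurentPoly r} {k : Fin r → ℤ}
    (hk : k ∈ exponents f) : latticePoint k ∈ newtonPolytope f :=
  subset_convexHull ℝ _ ⟨k, hk, rfl⟩

theorem newtonPolytope_nonempty {f : LaurentPoly r} (hf : f ≠ 0) :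
    (newtonPolytope f).Nonempty := by
  have : (exponents f).Nonempty := by
    rw [exponents, Finsupp.support_nonempty_iff]
    simpa using hf
  obtain ⟨k, hk⟩ := this
  exact ⟨_, latticePoint_mem_newtonPolytope hk⟩

/-- Exponents add under multiplication, and convexity gives `Δ + mΔ = (m + 1)Δ`. Non-emptiness
serves the empty product, where `0 • Δ` must contain the origin. -/
theorem latticePoint_mem_of_mem_exponents_prod {ι : Type*} (s : Finset ι) (g : ι → LaurentPoly r)
    {Δ : Set (EuclideanSpace ℝ (Fin r))} (hconv : Convex ℝ Δ) (hne : Δ.Nonempty)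
    (hg : ∀ i ∈ s, ∀ k ∈ exponents (g i), latticePoint k ∈ Δ) :
    ∀ k ∈ exponents (∏ i ∈ s, g i), latticePoint k ∈ (s.card : ℝ) • Δ := by
  classical
  induction s using Finset.induction_on with
  | empty =>
    intro k hk
    have : k = 0 := by
      by_contra h
      rw [exponents, Finsupp.mem_support_iff, Finset.prod_empty, AddMonoidAlgebra.one_def,
        AddMonoidAlgebra.coeff_single, Finsupp.single_apply, if_neg (Ne.symm h)] at hk
      exact hk rfl
    subst this
    rw [Finset.card_empty, Nat.cast_zero, Set.zero_smul_set hne]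
    ext i
    simp
  | insert i s hi ih =>
    intro k hk
    rw [Finset.prod_insert hi] at hk
    obtain ⟨a, ha, b, hb, rfl⟩ := Finset.mem_add.1
      (AddMonoidAlgebra.support_coeff_mul_subset _ _ hk)
    have h1 := hg i (Finset.mem_insert_self i s) a ha
    have h2 := ih (fun j hj => hg j (Finset.mem_insert_of_mem hj)) b hb
    rw [Finset.card_insert_of_notMem hi, Nat.cast_add, Nat.cast_one, add_comm,
      hconv.add_smul zero_le_one (Nat.cast_nonneg _), one_smul]
    refine ⟨_, h1, _, h2, ?_⟩
    ext j
    simp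

theorem latticePoint_mem_of_mem_exponents_cyclicResultant {n : ℕ} {f : LaurentPoly r}
    (hf : f ≠ 0) {k : Fin r → ℤ} (hk : k ∈ exponents (cyclicResultant n f)) :
    latticePoint k ∈ ((n : ℝ) ^ r) • newtonPolytope f := by
  have h := latticePoint_mem_of_mem_exponents_prod Finset.univ
    (fun κ : Fin r → Fin n => twist (rootPoint n κ) f) (convex_convexHull ℝ _)
    (newtonPolytope_nonempty hf)
    (fun κ _ k hk => latticePoint_mem_newtonPolytope (by rwa [exponents_twist] at hk)) k hk
  rwa [Finset.card_univ, Fintype.card_pi, Finset.prod_const, Finset.card_univ, Fintype.card_fin,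
    Fintype.card_fin, Nat.cast_pow] at h

/-- The cyclic resultant is invariant under rotation of a coordinate by a root of unity. -/
theorem eval_cyclicResultant_mulSingle {n : ℕ} [NeZero n] (f : LaurentPoly r) (z : Torus r)
    (i : Fin r) (ζ : ℂˣ) (hζ : (ζ : ℂ) = Complex.exp (2 * Real.pi * Complex.I / n)) :
    eval (cyclicResultant n f) (Pi.mulSingle i ζ * z) = eval (cyclicResultant n f) z := by
  rw [eval_cyclicResultant, eval_cyclicResultant]
  refine Fintype.prod_equiv (Equiv.addRight (Pi.single i 1)) _ _ fun κ => ?_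
  rw [← mul_assoc]
  congr 2
  funext j
  ext
  rw [Pi.mul_apply, Units.val_mul, rootPoint_apply, rootPoint_apply, Equiv.coe_addRight]
  beta_reduce
  rw [Pi.add_apply]
  rcases eq_or_ne j i with rfl | hj
  · have hroot : Complex.exp (2 * Real.pi * Complex.I / n) ^ n = 1 :=
      (Complex.isPrimitiveRoot_exp n (NeZero.ne n)).pow_eq_one
    -- Addition in `Fin n` wraps around, so the two powers are compared modulo the order `n` of the
    -- root.
    rw [Pi.mulSingle_eq_same, Pi.single_eq_same, hζ, ← pow_succ, Fin.val_add, ← pow_mod_orderOf,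
      ← pow_mod_orderOf _ ((_ + _) % n)]
    congr 1
    rw [← (Complex.isPrimitiveRoot_exp n (NeZero.ne n)).eq_orderOf, Nat.mod_mod, Fin.val_one',
      Nat.add_mod_mod]
  · rw [Pi.mulSingle_eq_of_ne hj, Pi.single_eq_of_ne hj]
    simp

/-- Rotating coordinate `i` by a primitive `n`-th root `ζ` fixes `f_n` but multiplies its
coefficient at `k` by `ζ ^ k i`; a non-zero coefficient forces `ζ ^ k i = 1`. -/
theorem dvd_of_mem_exponents_cyclicResultant {n : ℕ} (hn : n ≠ 0) {f : LaurentPoly r}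
    {k : Fin r → ℤ} (hk : k ∈ exponents (cyclicResultant n f)) (i : Fin r) : (n : ℤ) ∣ k i := by
  have : NeZero n := ⟨hn⟩
  obtain ⟨M, hM, hMb⟩ := exists_abs_sub_lt (exponents (cyclicResultant n f))
  set ζ : ℂˣ := Units.mk0 (Complex.exp (2 * Real.pi * Complex.I / n)) (Complex.exp_ne_zero _)
    with hζ
  have h1 := sum_rootPoint_mul_eval hM (cyclicResultant n f) (Pi.mulSingle i ζ) k
    (fun l hl => hMb l hl k hk)
  have h2 := sum_rootPoint_mul_eval hM (cyclicResultant n f) 1 k (fun l hl => hMb l hl k hk)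
  have h3 : ∀ w : Torus r, eval (cyclicResultant n f) (w * Pi.mulSingle i ζ) =
      eval (cyclicResultant n f) (w * 1) := fun w => by
    rw [mul_comm, mul_one]
    exact eval_cyclicResultant_mulSingle f w i ζ rfl
  simp only [h3] at h1
  have h4 := mul_left_cancel₀ (pow_ne_zero r (Nat.cast_ne_zero.2 hM)) (h1.symm.trans h2)
  have h5 : monomial (Pi.mulSingle i ζ) k = (ζ : ℂ) ^ k i := by
    rw [monomial, Finset.prod_eq_single i]
    · simp
    · intro j _ hj
      simp [hj]
    · simp
  have h6 : monomial (1 : Torus r) k = 1 := by simp [monomial]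
  rw [term, term, h5, h6] at h4
  have h7 := mul_left_cancel₀ (Finsupp.mem_support_iff.1 hk) h4
  exact ((Complex.isPrimitiveRoot_exp n hn).zpow_eq_one_iff_dvd _).1 h7

theorem finite_integralPoints {P : Set (EuclideanSpace ℝ (Fin r))} (hP : Bornology.IsBounded P) :
    (integralPoints P).Finite := by
  obtain ⟨R, hR⟩ := hP.exists_norm_le
  refine (Set.finite_Icc (fun _ : Fin r => -⌈R⌉) (fun _ => ⌈R⌉)).subset fun k hk => ?_
  have h : ∀ i, |k i| ≤ ⌈R⌉ := fun i => by
    have h1 := (PiLp.norm_apply_le (latticePoint k) i).trans (hR _ hk)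
    simp only [Real.norm_eq_abs] at h1
    exact_mod_cast h1.trans (Int.le_ceil R)
  exact ⟨fun i => (abs_le.1 (h i)).1, fun i => (abs_le.1 (h i)).2⟩

theorem isBounded_newtonPolytope (f : LaurentPoly r) :
    Bornology.IsBounded (newtonPolytope f) :=
  isBounded_convexHull.2 ((exponents f).finite_toSet.image _).isBounded

/-- The number of terms of the cyclic resultant. -/
theorem card_exponents_cyclicResultant_le {n : ℕ} (hn : n ≠ 0) {f : LaurentPoly r} (hf : f ≠ 0)
    {d : ℝ} (hd : IsLatticePointBound (newtonPolytope f) d) :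
    ((exponents (cyclicResultant n f)).card : ℝ) ≤ d * (n : ℝ) ^ (r ^ 2 - r) := by
  have hn0 : (n : ℝ) ≠ 0 := Nat.cast_ne_zero.2 hn
  set P : Set (EuclideanSpace ℝ (Fin r)) := ((n ^ (r - 1) : ℕ) : ℝ) • newtonPolytope f with hP
  have hfin : (integralPoints P).Finite :=
    finite_integralPoints ((isBounded_newtonPolytope f).smul₀ _)
  have hsub : (exponents (cyclicResultant n f) : Set (Fin r → ℤ)) ⊆
      (fun k i => (n : ℤ) * k i) '' integralPoints P := fun k hk => by
    choose l hl using dvd_of_mem_exponents_cyclicResultant hn hk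
    refine ⟨l, ?_, (funext hl).symm⟩
    have h1 := latticePoint_mem_of_mem_exponents_cyclicResultant hf hk
    -- For `r = 0` the truncated `r - 1` breaks `n ^ r = n * n ^ (r - 1)`, but then there is only
    -- one lattice point.
    rcases Nat.eq_zero_or_pos r with rfl | hr
    · rw [Subsingleton.elim k l] at h1
      simpa [integralPoints, hP] using h1
    · have h2 : latticePoint k = (n : ℝ) • latticePoint l := by
        ext i
        simp [hl]
      have h3 : (n : ℝ) ^ r = n * ((n ^ (r - 1) : ℕ) : ℝ) := by
        rw [Nat.cast_pow, ← pow_succ', Nat.sub_add_cancel hr]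
      rw [h2, h3, mul_smul, Set.smul_mem_smul_set_iff₀ hn0] at h1
      exact h1
  have h1 : (exponents (cyclicResultant n f)).card ≤ (integralPoints P).ncard := by
    rw [← Set.ncard_coe_finset]
    exact (Set.ncard_le_ncard hsub (hfin.image _)).trans (Set.ncard_image_le hfin)
  have h2 := hd (n ^ (r - 1)) (Nat.one_le_pow _ _ (Nat.pos_of_ne_zero hn))
  rw [div_le_iff₀ (by positivity), Nat.cast_pow, ← pow_mul, Nat.sub_mul, one_mul, ← sq] at h2
  refine le_trans (Nat.cast_le.2 h1) ?_
  rw [hP, Nat.cast_pow]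
  exact h2

/-! ### Relative errors that compose and multiply. -/

/-- `x` agrees with `y` up to `N` relative errors of size `η`. -/
def Near (η : ℝ) (N : ℕ) (x y : ℂ) : Prop := ‖x - y‖ ≤ ((1 + η) ^ N - 1) * ‖y‖

namespace Near

variable {η : ℝ} {N M : ℕ} {x y z x' y' : ℂ}

theorem refl (hη : 0 ≤ η) (N : ℕ) (x : ℂ) : Near η N x x := by
  rw [Near, sub_self, norm_zero]
  exact mul_nonneg (sub_nonneg.2 (one_le_pow₀ (by linarith))) (norm_nonneg _)

theorem norm_le (h : Near η N x y) : ‖x‖ ≤ (1 + η) ^ N * ‖y‖ := by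
  have h1 := norm_sub_norm_le x y
  rw [Near] at h
  linarith

theorem mono (hη : 0 ≤ η) (hNM : N ≤ M) (h : Near η N x y) : Near η M x y :=
  le_trans h (mul_le_mul_of_nonneg_right
    (sub_le_sub_right (pow_le_pow_right₀ (by linarith) hNM) 1) (norm_nonneg _))

theorem trans (hη : 0 ≤ η) (h : Near η N x y) (h' : Near η M y z) : Near η (N + M) x z := by
  have h1 := h'.norm_le
  have h2 : (0 : ℝ) ≤ (1 + η) ^ N - 1 := sub_nonneg.2 (one_le_pow₀ (by linarith))
  have h3 := norm_sub_le_norm_sub_add_norm_sub x y z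
  have h4 := mul_le_mul_of_nonneg_left h1 h2
  rw [Near] at *
  rw [pow_add]
  linarith

theorem mul_left (c : ℂ) (h : Near η N x y) : Near η N (c * x) (c * y) := by
  rw [Near] at *
  rw [← mul_sub, norm_mul, norm_mul, mul_left_comm]
  exact mul_le_mul_of_nonneg_left h (norm_nonneg _)

theorem mul (hη : 0 ≤ η) (h : Near η N x y) (h' : Near η M x' y') :
    Near η (N + M) (x * x') (y * y') := by
  have h1 := h.mul_left x'
  rw [mul_comm x', mul_comm x'] at h1
  exact h1.trans hη (h'.mul_left y)

end Near

/-! ### Cyclic products in one variable. -/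

/-- Take `s = 1` when `t ^ n` dominates and `s = 0` when `ρ ^ n` does. The discrepancy is then `1 -
u ^ n` times the smaller of the two powers. -/
theorem near_factor {n : ℕ} {q : ℝ} (hq0 : 0 ≤ q) (hq : q < 1) {t ρ : ℂ}
    (h : ‖ρ‖ ^ n ≤ q * ‖t‖ ^ n ∨ ‖t‖ ^ n ≤ q * ‖ρ‖ ^ n) :
    ∃ s : ℕ, s ≤ 1 ∧ ∀ u : Circle, Near (2 * q / (1 - q)) 1 (ρ ^ n - (u * t) ^ n)
      ((u : ℂ) ^ (n * s) * (ρ ^ n - t ^ n)) := by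
  have hq1 : 0 < 1 - q := sub_pos.2 hq
  have hu : ∀ u : Circle, ‖1 - (u : ℂ) ^ n‖ ≤ 2 := fun u => by
    refine (norm_sub_le _ _).trans ?_
    rw [norm_one, norm_pow, Circle.norm_coe, one_pow]
    norm_num
  have main : ∀ A B : ℝ, 0 ≤ A → A ≤ q * B → ∀ D : ℝ, B - A ≤ D →
      2 * A ≤ 2 * q / (1 - q) * D := fun A B hA hAB D hD => by
    rw [div_mul_eq_mul_div, le_div_iff₀ hq1]
    nlinarith
  rcases h with h | h
  · refine ⟨1, le_rfl, fun u => ?_⟩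
    have e : ρ ^ n - (u * t) ^ n - (u : ℂ) ^ (n * 1) * (ρ ^ n - t ^ n) =
        (1 - (u : ℂ) ^ n) * ρ ^ n := by
      rw [mul_one, mul_pow]
      ring
    rw [Near, e, norm_mul, norm_mul, norm_pow, norm_pow, Circle.norm_coe, one_pow, one_mul,
      pow_one, add_sub_cancel_left]
    refine (mul_le_mul_of_nonneg_right (hu u) (by positivity)).trans
      (main _ _ (by positivity) h _ ?_)
    have := norm_sub_norm_le (t ^ n) (ρ ^ n)
    rwa [norm_sub_rev, norm_pow, norm_pow] at this
  · refine ⟨0, zero_le_one, fun u => ?_⟩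
    have e : ρ ^ n - (u * t) ^ n - (u : ℂ) ^ (n * 0) * (ρ ^ n - t ^ n) =
        (1 - (u : ℂ) ^ n) * t ^ n := by
      rw [mul_zero, pow_zero, mul_pow]
      ring
    rw [Near, e, norm_mul, norm_mul, norm_pow, norm_pow, Circle.norm_coe, one_pow, one_mul,
      pow_one, add_sub_cancel_left]
    refine (mul_le_mul_of_nonneg_right (hu u) (by positivity)).trans
      (main _ _ (by positivity) h _ ?_)
    have := norm_sub_norm_le (ρ ^ n) (t ^ n)
    rwa [norm_pow, norm_pow] at this

theorem near_prod_factors {n : ℕ} {q : ℝ} (hq0 : 0 ≤ q) (hq : q < 1) {t : ℂ} (R : Multiset ℂ)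
    (h : ∀ ρ ∈ R, ‖ρ‖ ^ n ≤ q * ‖t‖ ^ n ∨ ‖t‖ ^ n ≤ q * ‖ρ‖ ^ n) :
    ∃ s : ℕ, s ≤ R.card ∧ ∀ u : Circle, Near (2 * q / (1 - q)) R.card
      (R.map fun ρ => ρ ^ n - (u * t) ^ n).prod
      ((u : ℂ) ^ (n * s) * (R.map fun ρ => ρ ^ n - t ^ n).prod) := by
  have hη : 0 ≤ 2 * q / (1 - q) := div_nonneg (by linarith) (by linarith)
  induction R using Multiset.induction_on with
  | empty => exact ⟨0, le_rfl, fun u => by simpa using Near.refl hη 0 1⟩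
  | cons ρ R ih =>
    obtain ⟨s, hs, hs'⟩ := ih fun ρ hρ => h ρ (Multiset.mem_cons_of_mem hρ)
    obtain ⟨s₁, hs₁, hs₁'⟩ := near_factor hq0 hq (h ρ (Multiset.mem_cons_self ρ R))
    refine ⟨s₁ + s, by rw [Multiset.card_cons]; omega, fun u => ?_⟩
    have h1 := (hs₁' u).mul hη (hs' u)
    rw [Multiset.map_cons, Multiset.prod_cons, Multiset.map_cons, Multiset.prod_cons,
      Multiset.card_cons, add_comm R.card 1, mul_add, pow_add]
    convert h1 using 1
    ring

theorem prod_sub_primitiveRoot_mul {n : ℕ} (hn : n ≠ 0) {ζ : ℂ} (hζ : IsPrimitiveRoot ζ n)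
    (ρ t : ℂ) : ∏ j : Fin n, (ρ - ζ ^ (j : ℕ) * t) = ρ ^ n - t ^ n := by
  have : NeZero n := ⟨hn⟩
  rw [hζ.pow_sub_pow_eq_prod_sub_mul ρ t (Nat.pos_of_ne_zero hn)]
  refine Finset.prod_bij (fun j _ => ζ ^ (j : ℕ)) (fun j _ => ?_) (fun i _ j _ hij => ?_)
    (fun b hb => ?_) (fun _ _ => rfl)
  · rw [Polynomial.mem_nthRootsFinset (Nat.pos_of_ne_zero hn), ← pow_mul, mul_comm, pow_mul,
      hζ.pow_eq_one, one_pow]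
  · exact Fin.ext (hζ.pow_inj i.2 j.2 hij)
  · obtain ⟨i, hi, rfl⟩ := hζ.eq_pow_of_pow_eq_one
      ((Polynomial.mem_nthRootsFinset (Nat.pos_of_ne_zero hn) 1).1 hb)
    exact ⟨⟨i, hi⟩, Finset.mem_univ _, rfl⟩

/-- The cyclic resultant in one variable of a factored Laurent polynomial, all of whose roots are
far from the circle through `t`, is nearly a monomial on this circle. -/
theorem near_cyclic_product {n : ℕ} (hn : n ≠ 0) {ζ : ℂ} (hζ : IsPrimitiveRoot ζ n) {q : ℝ}
    (hq0 : 0 ≤ q) (hq : q < 1) (B : ℕ) (C t : ℂ) (R : Multiset ℂ) (hR : R.card ≤ 2 * B)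
    (h : ∀ ρ ∈ R, ‖ρ‖ ^ n ≤ q * ‖t‖ ^ n ∨ ‖t‖ ^ n ≤ q * ‖ρ‖ ^ n) (g : ℂ → ℂ)
    (hg : ∀ t ≠ 0, g t = C * t ^ (-(B : ℤ)) * (R.map fun ρ => ρ - t).prod) (ht : t ≠ 0) :
    ∃ ν : ℤ, |ν| ≤ n * B ∧ ∀ u : Circle, Near (2 * q / (1 - q)) (2 * B)
      (∏ j : Fin n, g (ζ ^ (j : ℕ) * (u * t))) ((u : ℂ) ^ ν * ∏ j : Fin n, g (ζ ^ (j : ℕ) * t)) := by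
  have hη : 0 ≤ 2 * q / (1 - q) := div_nonneg (by linarith) (by linarith)
  have hζ0 : ζ ≠ 0 := hζ.ne_zero hn
  have hH : ∀ t ≠ 0, ∏ j : Fin n, g (ζ ^ (j : ℕ) * t) =
      (∏ j : Fin n, C * (ζ ^ (j : ℕ)) ^ (-(B : ℤ))) * t ^ (-(n * B : ℤ)) *
        (R.map fun ρ => ρ ^ n - t ^ n).prod := fun t ht => by
    have h1 : ∀ j : Fin n, g (ζ ^ (j : ℕ) * t) = C * (ζ ^ (j : ℕ)) ^ (-(B : ℤ)) *
        t ^ (-(B : ℤ)) * (R.map fun ρ => ρ - ζ ^ (j : ℕ) * t).prod := fun j => by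
      rw [hg _ (mul_ne_zero (pow_ne_zero _ hζ0) ht), mul_zpow, ← mul_assoc C]
    simp only [h1]
    rw [Finset.prod_mul_distrib, Finset.prod_mul_distrib]
    congr 1
    · congr 1
      rw [Finset.prod_const, Finset.card_univ, Fintype.card_fin, ← zpow_natCast, ← zpow_mul]
      congr 1
      ring
    · have h2 := Multiset.prod_map_prod_map (Finset.univ : Finset (Fin n)).val R
        (f := fun j ρ => ρ - ζ ^ (j : ℕ) * t)
      refine h2.trans ?_
      congr 2
      funext ρ
      exact prod_sub_primitiveRoot_mul hn hζ ρ t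
  obtain ⟨s, hs, hs'⟩ := near_prod_factors hq0 hq R h
  -- The roots contribute `n * s` with `0 ≤ s ≤ 2 * B`, and the pole factor `t ^ (-B)` contributes
  -- `-n * B`.
  refine ⟨n * (s - B), ?_, fun u => ?_⟩
  · rw [abs_mul, Nat.abs_cast]
    refine mul_le_mul_of_nonneg_left (abs_le.2 ⟨?_, ?_⟩) (Nat.cast_nonneg _) <;> omega
  · rw [hH _ (mul_ne_zero (Circle.coe_ne_zero u) ht), hH t ht]
    have h1 := ((hs' u).mono hη hR).mul_left
      ((∏ j : Fin n, C * (ζ ^ (j : ℕ)) ^ (-(B : ℤ))) * (u * t) ^ (-(n * B : ℤ)))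
    convert h1 using 1
    have h2 : (u : ℂ) ^ ((n : ℤ) * (s - B)) = (u : ℂ) ^ (-(n * B : ℤ)) * (u : ℂ) ^ (n * s) := by
      rw [← zpow_natCast, ← zpow_add₀ (Circle.coe_ne_zero u)]
      congr 1
      push_cast
      ring
    rw [h2, mul_zpow]
    ring

/-! ### From single coordinates to the whole torus. -/

theorem Near.prod {ι : Type*} {η : ℝ} (hη : 0 ≤ η) {N : ℕ} (s : Finset ι) {x y : ι → ℂ}
    (h : ∀ i ∈ s, Near η N (x i) (y i)) : Near η (s.card * N) (∏ i ∈ s, x i) (∏ i ∈ s, y i) := by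
  classical
  induction s using Finset.induction_on with
  | empty => exact Near.refl hη _ _
  | insert i s hi ih =>
    rw [Finset.prod_insert hi, Finset.prod_insert hi, Finset.card_insert_of_notMem hi, add_mul,
      one_mul, add_comm]
    exact (h i (Finset.mem_insert_self i s)).mul hη
      (ih fun j hj => h j (Finset.mem_insert_of_mem hj))

/-- With `t ^ (k - l) = -1` the two powers are antipodal; this separates different exponents. -/
theorem exists_circle_norm_zpow_sub {k l : ℤ} (hkl : k ≠ l) :
    ∃ t : Circle, ‖(t : ℂ) ^ k - (t : ℂ) ^ l‖ = 2 := by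
  have hne : ((k - l : ℤ) : ℝ) ≠ 0 := Int.cast_ne_zero.2 (sub_ne_zero.2 hkl)
  refine ⟨Circle.exp (Real.pi / (k - l : ℤ)), ?_⟩
  set t := Circle.exp (Real.pi / (k - l : ℤ)) with ht
  have h1 : (t : ℂ) ^ (k - l) = -1 := by
    rw [← Circle.coe_zpow, ht, ← Circle.exp_zsmul, zsmul_eq_mul, mul_div_cancel₀ _ hne,
      Circle.coe_exp, Complex.exp_pi_mul_I]
  have h2 : (t : ℂ) ^ k - (t : ℂ) ^ l = (t : ℂ) ^ l * -2 := by
    have h3 := zpow_add₀ (Circle.coe_ne_zero t) (k - l) l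
    rw [sub_add_cancel, h1] at h3
    rw [h3]
    ring
  rw [h2, norm_mul, norm_zpow, Circle.norm_coe, one_zpow]
  norm_num

/-- A function on a real torus that is nearly a monomial in each coordinate, is nearly a
monomial. -/
theorem exists_near_monomial {ι : Type*} [Fintype ι] [DecidableEq ι] (G : (ι → Circle) → ℂ)
    (hG : Continuous G) (h0 : ∀ u, G u ≠ 0) {η : ℝ} (hη : 0 ≤ η) {N : ℕ} {b : ℤ}
    (hN : ι → (1 + η) ^ N - 1 < 1)
    (h : ∀ u i, ∃ ν : ℤ, |ν| ≤ b ∧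
      ∀ t : Circle, Near η N (G (Pi.mulSingle i t * u)) ((t : ℂ) ^ ν * G u)) :
    ∃ K : ι → ℤ, ∀ u, Near η (Fintype.card ι * N) (G u) ((∏ i, (u i : ℂ) ^ K i) * G 1) := by
  have hK : ∀ i, ∃ K : ℤ, ∀ u (t : Circle),
      Near η N (G (Pi.mulSingle i t * u)) ((t : ℂ) ^ K * G u) := fun i => by
    -- Finitely many of the closed, pairwise disjoint sets `A k` cover the torus, so each non-empty
    -- one among them is clopen and hence everything.
    set A : ℤ → Set (ι → Circle) := fun k =>
      {u | ∀ t : Circle, Near η N (G (Pi.mulSingle i t * u)) ((t : ℂ) ^ k * G u)} with hA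
    have hclosed : ∀ k, IsClosed (A k) := fun k => by
      simp only [hA, Set.ofPred_forall]
      exact isClosed_iInter fun t => isClosed_le (by fun_prop) (by fun_prop)
    have hdisj : ∀ k l u, u ∈ A k → u ∈ A l → k = l := fun k l u hk hl => by
      by_contra hkl
      obtain ⟨t, ht⟩ := exists_circle_norm_zpow_sub hkl
      have h1 := hk t
      have h2 := hl t
      rw [Near, norm_mul, norm_zpow, Circle.norm_coe, one_zpow, one_mul] at h1 h2
      have h3 := norm_sub_le_norm_sub_add_norm_sub ((t : ℂ) ^ k * G u)
        (G (Pi.mulSingle i t * u)) ((t : ℂ) ^ l * G u)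
      rw [← sub_mul, norm_mul, ht, norm_sub_rev] at h3
      have h4 := mul_lt_mul_of_pos_right (hN i) (norm_pos_iff.2 (h0 u))
      linarith
    obtain ⟨K, hKb, hK1⟩ := h 1 i
    have hcompl : A K = (⋃ l ∈ (Set.Icc (-b) b \ {K}), A l)ᶜ := by
      ext u
      simp only [Set.mem_compl_iff, Set.mem_iUnion, not_exists]
      constructor
      · intro hu l hl hul
        exact hl.2 (hdisj _ _ u hul hu)
      · intro hu
        obtain ⟨ν, hν, hνA⟩ := h u i
        by_cases hνK : ν = K
        · exact hνK ▸ hνA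
        · exact absurd hνA (hu ν ⟨abs_le.1 hν, hνK⟩)
    have hclopen : IsClopen (A K) := by
      refine ⟨hclosed K, ?_⟩
      rw [hcompl]
      exact (((Set.finite_Icc _ _).subset Set.sdiff_subset).isClosed_biUnion
        fun l _ => hclosed l).isOpen_compl
    have huniv := hclopen.eq_univ ⟨1, hK1⟩
    exact ⟨K, fun u => huniv.ge (Set.mem_univ u)⟩
  choose K hK using hK
  refine ⟨K, fun u => ?_⟩
  -- Switch the coordinates from `1` to `u i` one at a time; each switch costs `N` errors.
  have key : ∀ s : Finset ι, Near η (s.card * N) (G (s.piecewise u 1))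
      ((∏ i ∈ s, (u i : ℂ) ^ K i) * G 1) := fun s => by
    induction s using Finset.induction_on with
    | empty => simpa using Near.refl hη 0 (G 1)
    | insert i s hi ih =>
      have h1 : (insert i s).piecewise u 1 = Pi.mulSingle i (u i) * s.piecewise u 1 := by
        funext j
        rcases eq_or_ne j i with rfl | hj
        · simp [hi]
        · simp [hj, Finset.piecewise, Finset.mem_insert]
      have h2 := (hK i (s.piecewise u 1) (u i)).trans hη (ih.mul_left ((u i : ℂ) ^ K i))
      rw [h1, Finset.prod_insert hi, Finset.card_insert_of_notMem hi, add_mul, one_mul, add_comm,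
        mul_assoc]
      exact h2
  simpa using key Finset.univ

/-! ### One-variable slices and the distance to the amoeba. -/

/-- Multiplication by `t ^ B` clears the poles and leaves a polynomial of degree at most `2 * B`,
which splits over `ℂ`. If the slice vanishes identically, `C = 0`. -/
theorem exists_factorization_eval_update (f : LaurentPoly r) {B : ℕ}
    (hB : ∀ k ∈ exponents f, ∀ i, |k i| ≤ B) (z : Torus r) (i : Fin r) :
    ∃ (C : ℂ) (R : Multiset ℂ), R.card ≤ 2 * B ∧ ∀ t : ℂˣ, eval f (Function.update z i t) =
      C * (t : ℂ) ^ (-(B : ℤ)) * (R.map fun ρ => ρ - (t : ℂ)).prod := by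
  classical
  set p : Polynomial ℂ := ∑ k ∈ exponents f,
    Polynomial.monomial (k i + B).toNat (f.coeff k * monomial (Function.update z i 1) k) with hp
  have hdeg : p.natDegree ≤ 2 * B := by
    refine Polynomial.natDegree_sum_le_of_forall_le _ _ fun k hk => ?_
    refine (Polynomial.natDegree_monomial_le _).trans ?_
    have := abs_le.1 (hB k hk i)
    omega
  refine ⟨p.leadingCoeff * (-1) ^ p.roots.card, p.roots, (p.card_roots').trans hdeg,
    fun t => ?_⟩
  have h1 : p.eval (t : ℂ) = (t : ℂ) ^ B * eval f (Function.update z i t) := by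
    rw [hp, Polynomial.eval_finsetSum, eval, Finset.mul_sum]
    refine Finset.sum_congr rfl fun k hk => ?_
    have h2 : Function.update z i t = Function.update z i 1 * Pi.mulSingle i t := by
      funext j
      rcases eq_or_ne j i with rfl | hj
      · simp
      · simp [hj]
    have h3 : monomial (Pi.mulSingle i t) k = (t : ℂ) ^ k i := by
      rw [monomial, Finset.prod_eq_single i]
      · simp
      · intro j _ hj
        simp [hj]
      · simp
    have h4 : (t : ℂ) ^ (k i + B).toNat = (t : ℂ) ^ k i * (t : ℂ) ^ B := by
      rw [← zpow_natCast, ← zpow_natCast, ← zpow_add₀ t.ne_zero, Int.toNat_of_nonneg]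
      have := abs_le.1 (hB k hk i)
      omega
    rw [Polynomial.eval_monomial, h4, term, h2, monomial_mul, h3]
    ring
  have h5 : p.eval (t : ℂ) = p.leadingCoeff * (p.roots.map fun ρ => (t : ℂ) - ρ).prod := by
    conv_lhs => rw [(IsAlgClosed.splits p).eq_prod_roots]
    simp [Polynomial.eval_multiset_prod, Multiset.map_map]
  have h6 : (p.roots.map fun ρ => (t : ℂ) - ρ).prod =
      (-1) ^ p.roots.card * (p.roots.map fun ρ => ρ - (t : ℂ)).prod := by
    have : (fun ρ => (t : ℂ) - ρ) = fun ρ => -1 * (ρ - (t : ℂ)) := by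
      funext ρ
      ring
    rw [this, Multiset.prod_map_mul, Multiset.map_const', Multiset.prod_replicate]
  rw [h5, h6] at h1
  have h7 : (t : ℂ) ^ B ≠ 0 := pow_ne_zero _ t.ne_zero
  rw [zpow_neg, zpow_natCast]
  field_simp
  linear_combination -h1

theorem eval_ne_zero_of_le_dist {f : LaurentPoly r} {a : EuclideanSpace ℝ (Fin r)} {ε : ℝ}
    (hε : 0 < ε) (ha : ∀ x ∈ amoeba f, ε ≤ dist a x) {z : Torus r} (hz : logMap z = a) :
    eval f z ≠ 0 := fun h => by
  have := ha a ⟨z, h, hz⟩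
  rw [dist_self] at this
  exact hε.not_ge this

/-- A zero of `f` that differs from a point `z` of `Log⁻¹(a)` in absolute value in one coordinate
only is far away from `z`. -/
theorem norm_le_or_norm_le_of_eval_eq_zero {f : LaurentPoly r} {a : EuclideanSpace ℝ (Fin r)}
    {ε : ℝ} (ha : ∀ x ∈ amoeba f, ε ≤ dist a x) {w : Torus r} {i : Fin r}
    (hw : ∀ j ≠ i, Real.log ‖(w j : ℂ)‖ = a j) (hw0 : eval f w = 0) {t : ℂ} (ht0 : t ≠ 0)
    (ht : Real.log ‖t‖ = a i) :
    ‖(w i : ℂ)‖ ≤ Real.exp (-ε) * ‖t‖ ∨ ‖t‖ ≤ Real.exp (-ε) * ‖(w i : ℂ)‖ := by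
  have h1 := ha _ ⟨w, hw0, rfl⟩
  have h2 : dist a (logMap w) = |a i - Real.log ‖(w i : ℂ)‖| := by
    rw [EuclideanSpace.dist_eq, Finset.sum_eq_single i, Real.sqrt_sq dist_nonneg, Real.dist_eq]
    · rfl
    · intro j _ hj
      simp [logMap, hw j hj]
    · simp
  have hwi : 0 < ‖(w i : ℂ)‖ := norm_pos_iff.2 (w i).ne_zero
  have hti : 0 < ‖t‖ := norm_pos_iff.2 ht0
  rw [h2, ← ht] at h1
  rcases le_abs.1 h1 with h | h
  · left
    rw [← Real.exp_log hti, ← Real.exp_log hwi, ← Real.exp_add, Real.exp_le_exp]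
    linarith
  · right
    rw [← Real.exp_log hti, ← Real.exp_log hwi, ← Real.exp_add, Real.exp_le_exp]
    linarith

/-- The relative error of a single factor `ρ ^ n - z ^ n`. -/
def factorError (ε : ℝ) (n : ℕ) : ℝ := 2 * Real.exp (-ε) ^ n / (1 - Real.exp (-ε) ^ n)

theorem exp_neg_pow_lt_one {ε : ℝ} (hε : 0 < ε) {n : ℕ} (hn : n ≠ 0) : Real.exp (-ε) ^ n < 1 :=
  pow_lt_one₀ (Real.exp_pos _).le (Real.exp_lt_one_iff.2 (neg_neg_of_pos hε)) hn

theorem factorError_nonneg {ε : ℝ} (hε : 0 < ε) {n : ℕ} (hn : n ≠ 0) : 0 ≤ factorError ε n :=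
  div_nonneg (by positivity) (sub_nonneg.2 (exp_neg_pow_lt_one hε hn).le)

theorem exists_near_eval_cyclicResultant {f : LaurentPoly r} {B : ℕ}
    (hB : ∀ k ∈ exponents f, ∀ i, |k i| ≤ B) {a : EuclideanSpace ℝ (Fin r)} {ε : ℝ} (hε : 0 < ε)
    (ha : ∀ x ∈ amoeba f, ε ≤ dist a x) {n : ℕ} (hn : n ≠ 0) {z : Torus r} (hz : logMap z = a)
    (i : Fin r) :
    ∃ ν : ℤ, |ν| ≤ n ^ (r - 1) * (n * B : ℤ) ∧ ∀ u : Circle,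
      Near (factorError ε n) (n ^ (r - 1) * (2 * B))
        (eval (cyclicResultant n f) (Pi.mulSingle i (Circle.toUnits u) * z))
        ((u : ℂ) ^ ν * eval (cyclicResultant n f) z) := by
  classical
  have hη := factorError_nonneg hε hn
  have hzj : ∀ j, Real.log ‖(z j : ℂ)‖ = a j := fun j => by rw [← hz]; rfl
  set ζ : ℂ := Complex.exp (2 * Real.pi * Complex.I / n) with hζdef
  have hζ : IsPrimitiveRoot ζ n := Complex.isPrimitiveRoot_exp n hn
  set ω : Fin n → ℂˣ := fun j => Units.mk0 (ζ ^ (j : ℕ)) (pow_ne_zero _ (Complex.exp_ne_zero _))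
    with hω
  have hωn : ∀ j, ‖(ω j : ℂ)‖ = 1 := fun j => by
    rw [hω, Units.val_mk0, norm_pow, hζ.norm'_eq_one hn, one_pow]
  set w : ({j // j ≠ i} → Fin n) → Torus r := fun κ j =>
    if h : j = i then 1 else ω (κ ⟨j, h⟩) * z j with hw
  set e := Equiv.funSplitAt i (Fin n) with he
  have hprod : ∀ t : ℂˣ, eval (cyclicResultant n f) (Pi.mulSingle i t * z) =
      ∏ κ : {j // j ≠ i} → Fin n, ∏ j : Fin n,
        eval f (Function.update (w κ) i (ω j * (t * z i))) := fun t => by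
    rw [eval_cyclicResultant, ← e.symm.prod_comp, Fintype.prod_prod_type_right]
    refine Finset.prod_congr rfl fun κ _ => Finset.prod_congr rfl fun j _ => ?_
    congr 1
    funext l
    ext
    rw [Pi.mul_apply, Units.val_mul, rootPoint_apply]
    rcases eq_or_ne l i with rfl | hl
    · simp [he, hω, hζdef, Equiv.funSplitAt, Equiv.piSplitAt]
    · simp [he, hω, hw, hζdef, Equiv.funSplitAt, Equiv.piSplitAt, hl]
  have hslice : ∀ κ : {j // j ≠ i} → Fin n, ∃ ν : ℤ, |ν| ≤ n * B ∧ ∀ u : Circle,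
      Near (factorError ε n) (2 * B)
        (∏ j : Fin n, eval f (Function.update (w κ) i (ω j * (Circle.toUnits u * z i))))
        ((u : ℂ) ^ ν * ∏ j : Fin n, eval f (Function.update (w κ) i (ω j * (1 * z i)))) :=
      fun κ => by
    obtain ⟨C, R, hR, hCR⟩ := exists_factorization_eval_update f hB (w κ) i
    have hsep : ∀ ρ ∈ R, ‖ρ‖ ^ n ≤ Real.exp (-ε) ^ n * ‖(z i : ℂ)‖ ^ n ∨
        ‖(z i : ℂ)‖ ^ n ≤ Real.exp (-ε) ^ n * ‖ρ‖ ^ n := fun ρ hρ => by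
      -- A root at `0` lies outside the torus, so the amoeba says nothing about it, but it satisfies
      -- the first alternative trivially.
      by_cases hρ0 : ρ = 0
      · left
        rw [hρ0, norm_zero, zero_pow hn]
        positivity
      · have h0 : eval f (Function.update (w κ) i (Units.mk0 ρ hρ0)) = 0 := by
          rw [hCR, mul_eq_zero]
          right
          exact Multiset.prod_eq_zero (Multiset.mem_map.2 ⟨ρ, hρ, sub_self ρ⟩)
        have h1 := norm_le_or_norm_le_of_eval_eq_zero ha (i := i) (fun j hj => by
          simp only [Function.update_of_ne hj, hw, dif_neg hj, Units.val_mul, norm_mul, hωn,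
            one_mul, hzj]) h0 (z i).ne_zero (hzj i)
        rw [Function.update_self, Units.val_mk0] at h1
        rw [← mul_pow, ← mul_pow]
        exact h1.imp (fun h => pow_le_pow_left₀ (norm_nonneg _) h n)
          (fun h => pow_le_pow_left₀ (norm_nonneg _) h n)
    obtain ⟨ν, hν, hν'⟩ := near_cyclic_product hn hζ (by positivity) (exp_neg_pow_lt_one hε hn) B
      C (z i) R hR hsep (fun t => C * t ^ (-(B : ℤ)) * (R.map fun ρ => ρ - t).prod)
      (fun _ _ => rfl) (z i).ne_zero
    refine ⟨ν, hν, fun u => ?_⟩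
    simp only [hCR]
    simpa [hω, factorError] using hν' u
  choose ν hν hν' using hslice
  have hcard : (Finset.univ : Finset ({j // j ≠ i} → Fin n)).card = n ^ (r - 1) := by
    simp
  refine ⟨∑ κ, ν κ, ?_, fun u => ?_⟩
  · refine (Finset.abs_sum_le_sum_abs _ _).trans ((Finset.sum_le_card_nsmul _ _ _
      fun κ _ => hν κ).trans ?_)
    rw [hcard, nsmul_eq_mul, Nat.cast_pow]
  · have h1 := Near.prod hη Finset.univ fun κ _ => hν' κ u
    have h2 := hprod 1
    rw [Pi.mulSingle_one, one_mul] at h2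
    have h3 : (u : ℂ) ^ (∑ κ, ν κ) = ∏ κ, (u : ℂ) ^ ν κ :=
      map_sum (⟨⟨fun k => Additive.ofMul ((u : ℂ) ^ k), by simp⟩,
        fun k l => congrArg Additive.ofMul (zpow_add₀ (Circle.coe_ne_zero u) k l)⟩ :
        ℤ →+ Additive ℂ) ν Finset.univ
    rw [hcard, Finset.prod_mul_distrib, ← hprod, ← h3, ← h2] at h1
    exact h1

/-! ### The fibres of `Log`, and closedness of the amoeba. -/

/-- The point of the fibre `Log⁻¹(a)` with given arguments. -/
def fibrePoint (a : EuclideanSpace ℝ (Fin r)) (u : Fin r → Circle) : Torus r :=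
  (fun i => Circle.toUnits (u i)) * expPoint a

theorem logMap_fibrePoint (a : EuclideanSpace ℝ (Fin r)) (u : Fin r → Circle) :
    logMap (fibrePoint a u) = a := by
  ext i
  simp only [logMap, fibrePoint, expPoint, Pi.mul_apply, Units.val_mul, Circle.toUnits_apply,
    Units.val_mk0, norm_mul, Complex.norm_exp, Complex.ofReal_re]
  rw [Circle.norm_coe, one_mul, Real.log_exp]

theorem exists_fibrePoint_eq (z : Torus r) : ∃ u, fibrePoint (logMap z) u = z := by
  refine ⟨fun i => Circle.exp (Complex.arg (z i)), ?_⟩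
  funext i
  ext
  have hz : 0 < ‖(z i : ℂ)‖ := norm_pos_iff.2 (z i).ne_zero
  simp only [fibrePoint, Pi.mul_apply, Units.val_mul, Circle.toUnits_apply, Units.val_mk0,
    Circle.coe_exp, expPoint, logMap]
  rw [← Complex.ofReal_exp, Real.exp_log hz, mul_comm, Complex.norm_mul_exp_arg_mul_I]

theorem continuous_eval_fibrePoint {X : Type*} [TopologicalSpace X] (f : LaurentPoly r)
    {a : X → EuclideanSpace ℝ (Fin r)} {u : X → Fin r → Circle} (ha : Continuous a)
    (hu : Continuous u) : Continuous fun x => eval f (fibrePoint (a x) (u x)) := by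
  unfold eval term monomial
  refine continuous_finsetSum _ fun k _ => continuous_const.mul
    (continuous_finsetProd _ fun i _ => Continuous.zpow₀ ?_ _ fun p => Or.inl (Units.ne_zero _))
  simp only [fibrePoint, Pi.mul_apply, Units.val_mul, Circle.toUnits_apply, Units.val_mk0,
    expPoint]
  fun_prop

/-- The amoeba is the projection of a closed set along the compact torus of arguments. This provides
the `ε` for a single point outside it. -/
theorem isClosed_amoeba (f : LaurentPoly r) : IsClosed (amoeba f) := by
  have h : amoeba f = Prod.fst '' {p : EuclideanSpace ℝ (Fin r) × (Fin r → Circle) |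
      eval f (fibrePoint p.1 p.2) = 0} := by
    ext x
    constructor
    · rintro ⟨z, hz, rfl⟩
      obtain ⟨u, hu⟩ := exists_fibrePoint_eq z
      exact ⟨(logMap z, u), by rw [Set.mem_ofPred_eq, hu]; exact hz, rfl⟩
    · rintro ⟨⟨x, u⟩, hp, rfl⟩
      exact ⟨fibrePoint x u, hp, logMap_fibrePoint x u⟩
  rw [h]
  exact isClosedMap_fst_of_compactSpace _
    (isClosed_eq (continuous_eval_fibrePoint f continuous_fst continuous_snd) continuous_const)

theorem exists_le_dist_amoeba {f : LaurentPoly r} {a : EuclideanSpace ℝ (Fin r)}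
    (ha : a ∉ amoeba f) : ∃ ε > 0, ∀ x ∈ amoeba f, ε ≤ dist a x := by
  obtain ⟨ε, hε, h⟩ := Metric.isOpen_iff.1 (isClosed_amoeba f).isOpen_compl a ha
  refine ⟨ε, hε, fun x hx => ?_⟩
  by_contra hlt
  exact h (Metric.mem_ball'.2 (not_le.1 hlt)) hx

/-! ### The dominant term and the decay of the error. -/

/-- The relative error of the approximation of a cyclic resultant by a monomial. -/
def resultantError (r B : ℕ) (ε : ℝ) (n : ℕ) : ℝ :=
  (1 + factorError ε n) ^ (r * (n ^ (r - 1) * (2 * B))) - 1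

theorem exists_near_monomial_cyclicResultant {f : LaurentPoly r} {B : ℕ}
    (hB : ∀ k ∈ exponents f, ∀ i, |k i| ≤ B) {a : EuclideanSpace ℝ (Fin r)} {ε : ℝ} (hε : 0 < ε)
    (ha : ∀ x ∈ amoeba f, ε ≤ dist a x) {n : ℕ} (hn : n ≠ 0)
    (hδ : resultantError r B ε n < 1)
    (hne : ∀ z, logMap z = a → eval (cyclicResultant n f) z ≠ 0) :
    ∃ K : Fin r → ℤ, ∀ u : Fin r → Circle,
      Near (factorError ε n) (r * (n ^ (r - 1) * (2 * B)))
        (eval (cyclicResultant n f) (fibrePoint a u))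
        ((∏ i, (u i : ℂ) ^ K i) * eval (cyclicResultant n f) (fibrePoint a 1)) := by
  have hη := factorError_nonneg hε hn
  have hN : Fin r → (1 + factorError ε n) ^ (n ^ (r - 1) * (2 * B)) - 1 < 1 := fun i => by
    refine lt_of_le_of_lt (sub_le_sub_right (pow_le_pow_right₀ (by linarith) ?_) 1) hδ
    exact Nat.le_mul_of_pos_left _ (Fin.pos i)
  have hcont : Continuous fun u : Fin r → Circle => eval (cyclicResultant n f) (fibrePoint a u) :=
    continuous_eval_fibrePoint _ continuous_const continuous_id
  have hstep : ∀ (u : Fin r → Circle) (i : Fin r), ∃ ν : ℤ,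
      |ν| ≤ n ^ (r - 1) * (n * B : ℤ) ∧ ∀ t : Circle,
        Near (factorError ε n) (n ^ (r - 1) * (2 * B))
          (eval (cyclicResultant n f) (fibrePoint a (Pi.mulSingle i t * u)))
          ((t : ℂ) ^ ν * eval (cyclicResultant n f) (fibrePoint a u)) := fun u i => by
    obtain ⟨ν, hν, hν'⟩ := exists_near_eval_cyclicResultant hB hε ha hn
      (logMap_fibrePoint a u) i
    refine ⟨ν, hν, fun t => ?_⟩
    have h1 : fibrePoint a (Pi.mulSingle i t * u) =
        Pi.mulSingle i (Circle.toUnits t) * fibrePoint a u := by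
      rw [fibrePoint, fibrePoint, ← mul_assoc]
      congr 1
      funext j
      rcases eq_or_ne j i with rfl | hj
      · simp
      · simp [hj]
    rw [h1]
    exact hν' t
  have h := exists_near_monomial _ hcont (fun u => hne _ (logMap_fibrePoint a u)) hη hN hstep
  rwa [Fintype.card_fin] at h

theorem exists_dominant_term {f : LaurentPoly r} {B : ℕ}
    (hB : ∀ k ∈ exponents f, ∀ i, |k i| ≤ B) {a : EuclideanSpace ℝ (Fin r)} {ε : ℝ} (hε : 0 < ε)
    (ha : ∀ x ∈ amoeba f, ε ≤ dist a x) {n : ℕ} (hn : n ≠ 0)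
    (hδ : resultantError r B ε n < 1) :
    ∃ A > 0, ∃ K ∈ exponents (cyclicResultant n f),
      (1 - resultantError r B ε n) * A ≤ termAbs (cyclicResultant n f) a K ∧
      ∀ k ∈ exponents (cyclicResultant n f), k ≠ K →
        termAbs (cyclicResultant n f) a k ≤ resultantError r B ε n * A := by
  have hne : ∀ z, logMap z = a → eval (cyclicResultant n f) z ≠ 0 := fun z hz => by
    rw [eval_cyclicResultant]
    refine Finset.prod_ne_zero_iff.2 fun κ _ => eval_ne_zero_of_le_dist hε ha ?_
    rw [← hz]
    ext i
    simp only [logMap, Pi.mul_apply, Units.val_mul, rootPoint_apply, norm_mul, norm_pow,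
      (Complex.isPrimitiveRoot_exp n hn).norm'_eq_one hn, one_pow, one_mul]
  obtain ⟨K, hK⟩ := exists_near_monomial_cyclicResultant hB hε ha hn hδ hne
  have h1 : fibrePoint a 1 = expPoint a := by
    rw [fibrePoint]
    simp only [Pi.one_apply, map_one]
    exact one_mul _
  rw [h1] at hK
  generalize cyclicResultant n f = F at *
  have hpos : 0 < ‖eval F (expPoint a)‖ :=
    norm_pos_iff.2 (h1 ▸ hne _ (logMap_fibrePoint a 1))
  obtain ⟨h2, h3⟩ := termAbs_of_near_monomial F (expPoint a) K
    (δ := resultantError r B ε n) fun u hu => by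
      obtain ⟨c, rfl⟩ : ∃ c : Fin r → Circle, (fun i => Circle.toUnits (c i)) = u := by
        refine ⟨fun i => ⟨u i, mem_sphere_zero_iff_norm.2 (hu i)⟩, funext fun i => ?_⟩
        exact Units.ext rfl
      have h4 := hK c
      have h5 : ∏ i, (c i : ℂ) ^ K i = monomial (fun i => Circle.toUnits (c i)) K := by
        simp only [monomial, Circle.toUnits_apply, Units.val_mk0]
      have h6 : ‖monomial (fun i => Circle.toUnits (c i)) K‖ = 1 := by
        rw [monomial, norm_prod]
        exact Finset.prod_eq_one fun i _ => by rw [norm_zpow, hu, one_zpow]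
      rw [h5, Near, norm_mul (monomial _ K), h6, one_mul] at h4
      exact h4
  refine ⟨_, hpos, K, ?_, h2, h3⟩
  -- A missing exponent would have term zero, against the positive lower bound `(1 - δ)|f_n|`.
  by_contra hKn
  rw [exponents, Finsupp.notMem_support_iff] at hKn
  rw [term, hKn, zero_mul, norm_zero] at h2
  exact (mul_pos (sub_pos.2 hδ) hpos).not_ge h2

theorem resultantError_nonneg (r B : ℕ) {ε : ℝ} (hε : 0 < ε) {n : ℕ} (hn : n ≠ 0) :
    0 ≤ resultantError r B ε n :=
  sub_nonneg.2 (one_le_pow₀ (by linarith [factorError_nonneg hε hn]))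

theorem tendsto_pow_mul_factorError {ε : ℝ} (hε : 0 < ε) (p : ℕ) :
    Filter.Tendsto (fun n : ℕ => (n : ℝ) ^ p * factorError ε n) Filter.atTop (nhds 0) := by
  have hq : |Real.exp (-ε)| < 1 := by
    rw [abs_of_pos (Real.exp_pos _)]
    exact Real.exp_lt_one_iff.2 (neg_neg_of_pos hε)
  have h1 := tendsto_pow_const_mul_const_pow_of_abs_lt_one p hq
  have h2 := (tendsto_pow_atTop_nhds_zero_of_abs_lt_one hq).const_sub 1
  rw [sub_zero] at h2
  have h3 := (h1.const_mul 2).div h2 one_ne_zero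
  rw [mul_zero, zero_div] at h3
  refine h3.congr fun n => ?_
  rw [factorError]
  simp only [Pi.div_apply]
  ring

/-- With `x = Nη`, one has `(1 + η)^N - 1 ≤ exp x - 1 ≤ 2x` once `x ≤ 1`. Here `N` is polynomial in
`n` and `η` decays exponentially. -/
theorem tendsto_pow_mul_resultantError (r B : ℕ) {ε : ℝ} (hε : 0 < ε) (p : ℕ) :
    Filter.Tendsto (fun n : ℕ => (n : ℝ) ^ p * resultantError r B ε n) Filter.atTop
      (nhds 0) := by
  set c : ℝ := r * (2 * B) with hc
  have hx : Filter.Tendsto (fun n : ℕ => c * ((n : ℝ) ^ (r - 1) * factorError ε n))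
      Filter.atTop (nhds 0) := by
    simpa using (tendsto_pow_mul_factorError hε (r - 1)).const_mul c
  have hy : Filter.Tendsto
      (fun n : ℕ => 2 * c * ((n : ℝ) ^ (p + (r - 1)) * factorError ε n))
      Filter.atTop (nhds 0) := by
    simpa using (tendsto_pow_mul_factorError hε (p + (r - 1))).const_mul (2 * c)
  refine squeeze_zero' ?_ ?_ hy
  · filter_upwards [Filter.eventually_ne_atTop 0] with n hn
    exact mul_nonneg (by positivity) (resultantError_nonneg r B hε hn)
  · filter_upwards [Filter.eventually_ne_atTop 0, hx.eventually (gt_mem_nhds one_pos)]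
      with n hn hn1
    have hη := factorError_nonneg hε hn
    set x := c * ((n : ℝ) ^ (r - 1) * factorError ε n) with hxdef
    have hx0 : 0 ≤ x := by positivity
    have h1 : resultantError r B ε n ≤ Real.exp x - 1 := by
      rw [resultantError]
      refine sub_le_sub_right ?_ 1
      have h2 : (1 + factorError ε n) ≤ Real.exp (factorError ε n) := by
        rw [add_comm]
        exact Real.add_one_le_exp _
      refine (pow_le_pow_left₀ (by linarith) h2 _).trans_eq ?_
      rw [← Real.exp_nat_mul]
      congr 1
      push_cast
      ring
    have h3 : Real.exp x - 1 ≤ 2 * x := by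
      have := Real.abs_exp_sub_one_le (x := x) (by rw [abs_of_nonneg hx0]; exact hn1.le)
      rw [abs_of_nonneg hx0] at this
      exact (le_abs_self _).trans this
    refine (mul_le_mul_of_nonneg_left (h1.trans h3) (by positivity)).trans_eq ?_
    rw [hxdef, pow_add]
    ring

/-! ### Uniform bounds and conclusion. -/

theorem exists_nat_norm_le_of_newtonPolytope (f : LaurentPoly r) :
    ∃ B : ℕ, ∀ x ∈ newtonPolytope f, ‖x‖ ≤ B := by
  obtain ⟨R, hR⟩ := (isBounded_newtonPolytope f).exists_norm_le
  exact ⟨⌈R⌉₊, fun x hx => (hR x hx).trans (Nat.le_ceil R)⟩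

theorem abs_le_of_mem_exponents {f : LaurentPoly r} {B : ℕ}
    (hB : ∀ x ∈ newtonPolytope f, ‖x‖ ≤ B) : ∀ k ∈ exponents f, ∀ i, |k i| ≤ B :=
  fun k hk i => by
    have h1 := (PiLp.norm_apply_le (latticePoint k) i).trans
      (hB _ (latticePoint_mem_newtonPolytope hk))
    simp only [Real.norm_eq_abs] at h1
    exact_mod_cast h1

theorem IsLatticePointBound.nonneg {Δ : Set (EuclideanSpace ℝ (Fin r))} {d : ℝ}
    (hd : IsLatticePointBound Δ d) : 0 ≤ d :=
  le_trans (by positivity) (hd 1 le_rfl)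

/-- The statement on ratios comes without a `d`. One exists since `mΔ` lies in a cube with `(2mB +
1)^r ≤ ((2B + 1)m)^r` lattice points. -/
theorem exists_isLatticePointBound (f : LaurentPoly r) :
    ∃ d, IsLatticePointBound (newtonPolytope f) d := by
  obtain ⟨B, hB⟩ := exists_nat_norm_le_of_newtonPolytope f
  refine ⟨(2 * B + 1) ^ r, fun m hm => ?_⟩
  have hm0 : (0 : ℝ) < m := Nat.cast_pos.2 hm
  have hsub : integralPoints ((m : ℝ) • newtonPolytope f) ⊆
      (Finset.Icc (fun _ : Fin r => -(m * B : ℤ)) (fun _ => (m * B : ℤ)) : Set (Fin r → ℤ)) := by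
    rintro k ⟨x, hx, hxk⟩
    have h1 : ∀ i, |k i| ≤ m * B := fun i => by
      have h2 : ‖latticePoint k‖ ≤ m * B := by
        change (m : ℝ) • x = latticePoint k at hxk
        rw [← hxk, norm_smul, Real.norm_natCast]
        exact mul_le_mul_of_nonneg_left (hB x hx) hm0.le
      have h3 := (PiLp.norm_apply_le (latticePoint k) i).trans h2
      simp only [Real.norm_eq_abs] at h3
      exact_mod_cast h3
    exact Finset.mem_coe.2 (Finset.mem_Icc.2
      ⟨fun i => (abs_le.1 (h1 i)).1, fun i => (abs_le.1 (h1 i)).2⟩)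
  have hcard := Set.ncard_le_ncard hsub (Finset.finite_toSet _)
  rw [Set.ncard_coe_finset, Pi.card_Icc, Finset.prod_const, Finset.card_univ, Fintype.card_fin,
    Int.card_Icc] at hcard
  have hnum : ((m * B + 1 - -(m * B) : ℤ)).toNat ≤ (2 * B + 1) * m := by
    rw [Int.toNat_le]
    push_cast
    have : (1 : ℤ) ≤ m := by exact_mod_cast hm
    nlinarith
  rw [div_le_iff₀ (pow_pos hm0 r), ← mul_pow]
  exact_mod_cast hcard.trans (Nat.pow_le_pow_left hnum r)

theorem superlopsided_cyclicResultant {f : LaurentPoly r} {B : ℕ}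
    (hB : ∀ x ∈ newtonPolytope f, ‖x‖ ≤ B) {a : EuclideanSpace ℝ (Fin r)} {ε : ℝ} (hε : 0 < ε)
    (ha : ∀ x ∈ amoeba f, ε ≤ dist a x) (hf : f ≠ 0) {d α : ℝ}
    (hd : IsLatticePointBound (newtonPolytope f) d) (hα : d < α) {n : ℕ} (hn : n ≠ 0)
    (hδ : resultantError r B ε n < 1)
    (hδα : α * (n : ℝ) ^ (r ^ 2 - r) * resultantError r B ε n < 1 - resultantError r B ε n) :
    Superlopsided (exponents (cyclicResultant n f)) (termAbs (cyclicResultant n f) a)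
      (α * (n : ℝ) ^ (r ^ 2 - r)) := by
  have hnp : (0 : ℝ) < (n : ℝ) ^ (r ^ 2 - r) :=
    pow_pos (Nat.cast_pos.2 (Nat.pos_of_ne_zero hn)) _
  have hd0 := hd.nonneg
  refine ⟨?_, ?_⟩
  · have h1 := card_exponents_cyclicResultant_le hn hf hd
    have h2 := mul_le_mul_of_nonneg_right hα.le hnp.le
    linarith
  · obtain ⟨A, hA, K, hK, h1, h2⟩ :=
      exists_dominant_term (abs_le_of_mem_exponents hB) hε ha hn hδ
    refine ⟨K, hK, fun j hj hjK => ?_⟩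
    calc α * (n : ℝ) ^ (r ^ 2 - r) * termAbs (cyclicResultant n f) a j
        ≤ α * (n : ℝ) ^ (r ^ 2 - r) * (resultantError r B ε n * A) :=
          mul_le_mul_of_nonneg_left (h2 j hj hjK) (mul_nonneg (hd0.trans hα.le) hnp.le)
      _ = α * (n : ℝ) ^ (r ^ 2 - r) * resultantError r B ε n * A := by ring
      _ < (1 - resultantError r B ε n) * A := mul_lt_mul_of_pos_right hδα hA
      _ ≤ _ := h1

theorem eventually_resultantError_lt (r B : ℕ) {ε : ℝ} (hε : 0 < ε) {c : ℝ} (hc : 0 < c) :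
    ∀ᶠ n : ℕ in Filter.atTop, resultantError r B ε n < c := by
  have h := tendsto_pow_mul_resultantError r B hε 0
  simp only [pow_zero, one_mul] at h
  exact h.eventually (gt_mem_nhds hc)

theorem ne_zero_of_le_dist_amoeba {f : LaurentPoly r} {a : EuclideanSpace ℝ (Fin r)} {ε : ℝ}
    (hε : 0 < ε) (ha : ∀ x ∈ amoeba f, ε ≤ dist a x) : f ≠ 0 := by
  rintro rfl
  refine eval_ne_zero_of_le_dist hε ha (logMap_fibrePoint a 1) ?_
  rw [← evalHom_apply, map_zero]

/-- Cyclic resultants are superlopsided, uniformly in terms of the Newton polytope. -/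
theorem exists_forall_superlopsided (Δ : Set (EuclideanSpace ℝ (Fin r))) (d α ε : ℝ)
    (hd : IsLatticePointBound Δ d) (hα : d < α) (hε : 0 < ε) :
    ∃ N : ℕ, ∀ n : ℕ, N ≤ n → ∀ f : LaurentPoly r, newtonPolytope f = Δ →
      ∀ a : EuclideanSpace ℝ (Fin r), (∀ x ∈ amoeba f, ε ≤ dist a x) →
        Superlopsided (exponents (cyclicResultant n f)) (termAbs (cyclicResultant n f) a)
          (α * (n : ℝ) ^ (r ^ 2 - r)) := by
  by_cases hΔ : ∃ f : LaurentPoly r, newtonPolytope f = Δ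
  swap
  · exact ⟨0, fun n _ f hf => absurd ⟨f, hf⟩ hΔ⟩
  -- `f₀` only serves to show that `Δ` is bounded; the resulting `B` works for every `f` with this
  -- polytope.
  obtain ⟨f₀, rfl⟩ := hΔ
  obtain ⟨B, hB⟩ := exists_nat_norm_le_of_newtonPolytope f₀
  have h1 : Filter.Tendsto (fun n : ℕ => α * ((n : ℝ) ^ (r ^ 2 - r) * resultantError r B ε n))
      Filter.atTop (nhds 0) := by
    simpa using (tendsto_pow_mul_resultantError r B hε (r ^ 2 - r)).const_mul α
  have h2 := ((h1.eventually (gt_mem_nhds one_half_pos)).and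
    (eventually_resultantError_lt r B hε one_half_pos)).and (Filter.eventually_ne_atTop 0)
  obtain ⟨N, hN⟩ := Filter.eventually_atTop.1 h2
  refine ⟨N, fun n hn f hf a ha => ?_⟩
  obtain ⟨⟨h3, h4⟩, h5⟩ := hN n hn
  refine superlopsided_cyclicResultant (hf ▸ hB) hε ha (ne_zero_of_le_dist_amoeba hε ha)
    (hf ▸ hd) hα h5 (by linarith) ?_
  rw [mul_assoc]
  linarith

theorem exists_dominant_term_sequence {f : LaurentPoly r} {a : EuclideanSpace ℝ (Fin r)}
    (ha : a ∉ amoeba f) : ∃ k : ℕ → (Fin r → ℤ),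
      (∀ᶠ n : ℕ in Filter.atTop,
        k n ∈ exponents (cyclicResultant n f) ∧
        ∑ j ∈ (exponents (cyclicResultant n f)).erase (k n), termAbs (cyclicResultant n f) a j
          < termAbs (cyclicResultant n f) a (k n)) ∧
      Filter.Tendsto
        (fun n : ℕ =>
          (∑ j ∈ (exponents (cyclicResultant n f)).erase (k n),
            termAbs (cyclicResultant n f) a j) / termAbs (cyclicResultant n f) a (k n))
        Filter.atTop (nhds 0) := by
  obtain ⟨ε, hε, hdist⟩ := exists_le_dist_amoeba ha
  obtain ⟨B, hB⟩ := exists_nat_norm_le_of_newtonPolytope f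
  obtain ⟨d, hd⟩ := exists_isLatticePointBound f
  have hf := ne_zero_of_le_dist_amoeba hε hdist
  have hsmall : ∀ᶠ n : ℕ in Filter.atTop, resultantError r B ε n < 1 / 2 ∧ n ≠ 0 :=
    (eventually_resultantError_lt r B hε one_half_pos).and (Filter.eventually_ne_atTop 0)
  -- For the finitely many `n` without a good estimate `K` is set to `0`. The constant `2 * d`
  -- combines the number of terms with the lower bound `A / 2` for the dominant one.
  have hex : ∀ n : ℕ, ∃ K : Fin r → ℤ, resultantError r B ε n < 1 / 2 ∧ n ≠ 0 →
      K ∈ exponents (cyclicResultant n f) ∧ 0 < termAbs (cyclicResultant n f) a K ∧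
      (∑ j ∈ (exponents (cyclicResultant n f)).erase K, termAbs (cyclicResultant n f) a j) /
        termAbs (cyclicResultant n f) a K ≤
        2 * d * ((n : ℝ) ^ (r ^ 2 - r) * resultantError r B ε n) := fun n => by
    by_cases hn : resultantError r B ε n < 1 / 2 ∧ n ≠ 0
    swap
    · exact ⟨0, fun h => absurd h hn⟩
    obtain ⟨hδ, hn⟩ := hn
    have hδ0 := resultantError_nonneg r B hε hn
    obtain ⟨A, hA, K, hK, h1, h2⟩ := exists_dominant_term (abs_le_of_mem_exponents hB) hε hdist hn
      (hδ.trans one_half_lt_one)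
    have h3 : A / 2 ≤ termAbs (cyclicResultant n f) a K := by nlinarith
    have hpos : 0 < termAbs (cyclicResultant n f) a K := lt_of_lt_of_le (half_pos hA) h3
    refine ⟨K, fun _ => ⟨hK, hpos, ?_⟩⟩
    rw [div_le_iff₀ hpos]
    have h4 := Finset.sum_le_card_nsmul ((exponents (cyclicResultant n f)).erase K)
      (termAbs (cyclicResultant n f) a) _
      fun j hj => h2 j (Finset.mem_of_mem_erase hj) (Finset.ne_of_mem_erase hj)
    have h5 : (((exponents (cyclicResultant n f)).erase K).card : ℝ) ≤
        d * (n : ℝ) ^ (r ^ 2 - r) :=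
      (Nat.cast_le.2 (Finset.card_le_card (Finset.erase_subset _ _))).trans
        (card_exponents_cyclicResultant_le hn hf hd)
    have h6 : 0 ≤ 2 * d * ((n : ℝ) ^ (r ^ 2 - r) * resultantError r B ε n) :=
      mul_nonneg (mul_nonneg zero_le_two hd.nonneg) (mul_nonneg (by positivity) hδ0)
    rw [nsmul_eq_mul] at h4
    refine h4.trans ((mul_le_mul_of_nonneg_right h5 (mul_nonneg hδ0 hA.le)).trans ?_)
    refine le_trans (le_of_eq ?_) (mul_le_mul_of_nonneg_left h3 h6)
    ring
  choose k hk using hex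
  have hbound : Filter.Tendsto
      (fun n : ℕ => 2 * d * ((n : ℝ) ^ (r ^ 2 - r) * resultantError r B ε n))
      Filter.atTop (nhds 0) := by
    simpa using (tendsto_pow_mul_resultantError r B hε (r ^ 2 - r)).const_mul (2 * d)
  refine ⟨k, ?_, ?_⟩
  · filter_upwards [hsmall, hbound.eventually (gt_mem_nhds one_pos)] with n hn hn1
    obtain ⟨h1, h2, h3⟩ := hk n hn
    exact ⟨h1, (div_lt_one h2).1 (h3.trans_lt hn1)⟩
  · refine squeeze_zero' (Filter.Eventually.of_forall fun n => ?_) ?_ hbound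
    · exact div_nonneg (Finset.sum_nonneg fun j _ => norm_nonneg _) (norm_nonneg _)
    · filter_upwards [hsmall] with n hn
      exact (hk n hn).2.2

end Amoeba

end

open Amoeba in
theorem corollary3p8 {r : ℕ} :
    -- uniform form: `N` depends only on the Newton polytope `Δ`, on `α` and on `ε`
    (∀ (Δ : Set (EuclideanSpace ℝ (Fin r))) (d α ε : ℝ),
      IsLatticePointBound Δ d → d < α → 0 < ε →
      ∃ N : ℕ, ∀ n : ℕ, N ≤ n → ∀ f : LaurentPoly r, newtonPolytope f = Δ →
        ∀ a : EuclideanSpace ℝ (Fin r), (∀ x ∈ amoeba f, ε ≤ dist a x) →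
          Superlopsided (exponents (cyclicResultant n f)) (termAbs (cyclicResultant n f) a)
            (α * (n : ℝ) ^ (r ^ 2 - r))) ∧
    ∀ (f : LaurentPoly r) (a : EuclideanSpace ℝ (Fin r)), a ∉ amoeba f →
      -- every point outside the amoeba
      (∀ d α : ℝ, IsLatticePointBound (newtonPolytope f) d → d < α →
        ∀ᶠ n : ℕ in Filter.atTop,
          Superlopsided (exponents (cyclicResultant n f)) (termAbs (cyclicResultant n f) a)
            (α * (n : ℝ) ^ (r ^ 2 - r))) ∧
      -- a dominant term, and the limit of the ratio
      ∃ k : ℕ → (Fin r → ℤ),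
        (∀ᶠ n : ℕ in Filter.atTop,
          k n ∈ exponents (cyclicResultant n f) ∧
          ∑ j ∈ (exponents (cyclicResultant n f)).erase (k n), termAbs (cyclicResultant n f) a j
            < termAbs (cyclicResultant n f) a (k n)) ∧
        Filter.Tendsto
          (fun n : ℕ =>
            (∑ j ∈ (exponents (cyclicResultant n f)).erase (k n),
              termAbs (cyclicResultant n f) a j) / termAbs (cyclicResultant n f) a (k n))
          Filter.atTop (nhds 0) := by
  refine ⟨exists_forall_superlopsided, fun f a ha =>
    ⟨fun d α hd hα => ?_, exists_dominant_term_sequence ha⟩⟩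
  obtain ⟨ε, hε, hdist⟩ := exists_le_dist_amoeba ha
  obtain ⟨N, hN⟩ := exists_forall_superlopsided _ d α ε hd hα hε
  exact Filter.eventually_atTop.2 ⟨N, fun n hn => hN n hn f rfl a hdist⟩
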